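/- Let $G=(V,E)$ be a finite undirected graph with $|V|\ge 2$ and edge weights $w_{ij}\ge 0$ ($ij\in E$; put $w_{ij}=0$ for non-edges). For $S\subset V$ let $|\partial S|=\sum_{i\in S,\,j\in V\setminus S}w_{ij}$, and for $x\in\mathbb{R}^V$ let $\|x\|_\infty=\max_i|x_i|$. For a convex function $F:\mathbb{R}^V\to\mathbb{R}$ let $\nabla F(x)=\{u\in\mathbb{R}^V: F(y)-F(x)\ge\langle u,y-x\rangle\ \text{for all } y\}$ be its sub-gradient. A number $\lambda\in\mathbb{R}$ is called an eigenvalue, with eigenvector $x\in\mathbb{R}^V\setminus\{0\}$, if $$0\in\nabla\Big(\sum_{ij\in E}w_{ij}|x_i-x_j|\Big)-\lambda\,\nabla\big(2\|x\|_\infty\big),\qquad (*)$$ where $A-\lambda B=\{a-\lambda b: a\in A,\ b\in B\}$ and both sub-gradients are taken at $x$. Then: 1. $0$ is the smallest eigenvalue of $(*)$; it is the trivial one: nonzero constant vectors are eigenvectors, and only for the eigenvalue $0$. 2. (Min-cut) $$\min_{S\ne\varnothing,V}|\partial S|=\min_{\substack{x\neq 0\\ \min_i x_i+\max_i x_i=0}}\frac{\sum_{ij\in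 E}w_{ij}|x_i-x_j|}{2\|x\|_\infty}=\tilde\lambda_2,$$ where $\tilde\lambda_2$ is the second, i.e. the smallest nontrivial, eigenvalue of $(*)$: the smallest eigenvalue that has a nonconstant eigenvector. If $G$ is connected and all weights of edges are positive, $\tilde\lambda_2$ is also the smallest nonzero eigenvalue of $(*)$. 3. (Max-cut) $$\max_{S\ne\varnothing,V}|\partial S|=\max_{x\ne 0}\frac{\sum_{ij\in E}w_{ij}|x_i-x_j|}{2\|x\|_\infty}=\tilde\lambda_{\max},$$ where $\tilde\lambda_{\max}$ is the largest eigenvalue of $(*)$. All the minima and maxima are attained. -/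

import Mathlib

open scoped Pointwise

/-- The difference `|x i - x j|` along an unordered pair `ij`. -/
def edgeDiff {V : Type*} (x : V → ℝ) : Sym2 V → ℝ :=
  Sym2.lift ⟨fun i j => |x i - x j|, fun i j => abs_sub_comm (x i) (x j)⟩

/-- The total variation `∑_{ij ∈ E} w_ij |x_i - x_j|` of `x` on the graph `G` with edge
weights `w`; every undirected edge is counted once. -/
def totalVariation {V : Type*} [Fintype V] [DecidableEq V] (G : SimpleGraph V)
    [DecidableRel G.Adj] (w : Sym2 V → ℝ) (x : V → ℝ) : ℝ :=
  ∑ e ∈ G.edgeFinset, w e * edgeDiff x e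

/-- The weight `|∂S| = ∑_{i ∈ S, j ∉ S} w_ij` of the cut `(S, V \ S)`, where `w_ij = 0` if `ij`
is not an edge. -/
def cutWeight {V : Type*} [Fintype V] [DecidableEq V] (G : SimpleGraph V)
    [DecidableRel G.Adj] (w : Sym2 V → ℝ) (S : Finset V) : ℝ :=
  ∑ i ∈ S, ∑ j ∈ Sᶜ, if G.Adj i j then w s(i, j) else 0

/-- The sub-gradient at `x` of a convex function `F` on `ℝ^V`: all `u` (functionals being
identified with vectors through the dot product) with `F y - F x ≥ ⟨u, y - x⟩` for all `y`. -/
def subgradient {V : Type*} [Fintype V] (F : (V → ℝ) → ℝ) (x : V → ℝ) : Set (V → ℝ) :=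
  {u | ∀ y : V → ℝ, u ⬝ᵥ (y - x) ≤ F y - F x}

/-- `(lam, x)` is an eigenpair of the pair `(F, H)` of convex functions: `x ≠ 0` and
`0 ∈ ∇F(x) - lam ∇H(x)`, in the sense of Minkowski sums of sets. -/
def IsEigenpair {V : Type*} [Fintype V] (F H : (V → ℝ) → ℝ) (lam : ℝ) (x : V → ℝ) : Prop :=
  x ≠ 0 ∧ (0 : V → ℝ) ∈ subgradient F x - lam • subgradient H x

/-- `(lam, x)` is an eigenpair of the cut eigenvalue problem
`0 ∈ ∇ ∑_{ij ∈ E} w_ij |x_i - x_j| - lam ∇ 2‖x‖_∞`.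
The norm of `V → ℝ` is the sup norm `max_i |x_i|`. -/
def IsCutEigenpair {V : Type*} [Fintype V] [DecidableEq V] (G : SimpleGraph V)
    [DecidableRel G.Adj] (w : Sym2 V → ℝ) (lam : ℝ) (x : V → ℝ) : Prop :=
  IsEigenpair (totalVariation G w) (fun y => 2 * ‖y‖) lam x

/-- The set of eigenvalues of the cut eigenvalue problem. -/
def cutEigenvalues {V : Type*} [Fintype V] [DecidableEq V] (G : SimpleGraph V)
    [DecidableRel G.Adj] (w : Sym2 V → ℝ) : Set ℝ :=
  {lam | ∃ x : V → ℝ, IsCutEigenpair G w lam x}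

/-- The eigenvalues of the cut eigenvalue problem that belong to constant eigenvectors. -/
def trivialCutEigenvalues {V : Type*} [Fintype V] [DecidableEq V] (G : SimpleGraph V)
    [DecidableRel G.Adj] (w : Sym2 V → ℝ) : Set ℝ :=
  {lam | ∃ x : V → ℝ, (∀ i j, x i = x j) ∧ IsCutEigenpair G w lam x}

/-- The eigenvalues of the cut eigenvalue problem that have a nonconstant eigenvector. -/
def nontrivialCutEigenvalues {V : Type*} [Fintype V] [DecidableEq V] (G : SimpleGraph V)
    [DecidableRel G.Adj] (w : Sym2 V → ℝ) : Set ℝ :=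
  {lam | ∃ x : V → ℝ, (¬ ∀ i j, x i = x j) ∧ IsCutEigenpair G w lam x}

/-!
The argument rests on three facts about the total variation `I(x) = ∑ w_ij |x_i - x_j|`.

* Coarea formula (`totalVariation_eq_integral_cutWeight`): `I(x)` is the integral over
  `t ∈ [min x, max x]` of the weights of the cuts `{i | t ≤ x i}`. For `t` strictly between the
  two ends these cuts are proper, so a bound `m ≤ |∂S| ≤ M` for all proper cuts gives
  `m (max x - min x) ≤ I(x) ≤ M (max x - min x)`. As `max x - min x ≤ 2‖x‖`, with equality if
  `min x + max x = 0`, both variational formulas follow; the extremal vectors are the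
  `±1`-valued vectors `cutSign S` of extremal cuts.

* Necessary conditions for eigenpairs. Both functions are positively homogeneous, so Euler's
  identity gives `I(x) = lam * 2‖x‖` for each eigenpair (`IsCutEigenpair.totalVariation_eq`):
  eigenvalues are values of the quotient `I(x) / (2‖x‖)`. Moreover `I` is invariant under adding
  constants, so subgradients of `I` are orthogonal to the constants. If `lam ≠ 0`, the
  corresponding subgradient of `2‖·‖` is too, hence no shift of `x` by a constant has a smaller
  norm, which means `min x + max x = 0` (`IsCutEigenpair.iInf_add_iSup_eq_zero`). A nonconstant
  eigenvector for the eigenvalue `0` becomes admissible after such a shift.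

* Every proper cut weight is an eigenvalue (`isCutEigenpair_cutSign`). The functional
  `y ↦ ∑_{i ∈ S, j ∉ S} w_ij (y_i - y_j)` is a subgradient of `I` at `cutSign S`, and divided by
  `|∂S|` it is a subgradient of `2‖·‖` there. If `|∂S| = 0`, then `0` is a subgradient of `I` and
  any subgradient of `2‖·‖` will do.
-/

open MeasureTheory

/-! ### Subgradients and eigenpairs -/

section Subgradient

variable {V : Type*} [Fintype V]

lemma mem_subgradient_of_le {F : (V → ℝ) → ℝ} {x u : V → ℝ} (hx : u ⬝ᵥ x = F x)
    (hle : ∀ y, u ⬝ᵥ y ≤ F y) : u ∈ subgradient F x := by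
  intro y
  rw [dotProduct_sub, hx]
  linarith [hle y]

/-- Euler's identity for subgradients of positively homogeneous functions; homogeneity is needed
for the factors `0` and `2` only. -/
lemma dotProduct_eq_of_mem_subgradient {F : (V → ℝ) → ℝ} {x u : V → ℝ} (h0 : F 0 = 0)
    (h2 : F ((2 : ℝ) • x) = 2 * F x) (hu : u ∈ subgradient F x) : u ⬝ᵥ x = F x := by
  have h₁ := hu 0
  have h₂ := hu ((2 : ℝ) • x)
  simp only [dotProduct_sub, dotProduct_smul, dotProduct_zero, smul_eq_mul] at h₁ h₂
  linarith

lemma isEigenpair_iff {F H : (V → ℝ) → ℝ} {lam : ℝ} {x : V → ℝ} :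
    IsEigenpair F H lam x ↔ x ≠ 0 ∧ ∃ v ∈ subgradient H x, lam • v ∈ subgradient F x := by
  refine and_congr_right fun _ => ?_
  constructor
  · rintro ⟨u, hu, _, ⟨v, hv, rfl⟩, h⟩
    have huv : u = lam • v := sub_eq_zero.1 h
    exact ⟨v, hv, huv ▸ hu⟩
  · rintro ⟨v, hv, hu⟩
    exact ⟨_, hu, _, ⟨v, hv, rfl⟩, sub_self _⟩

lemma dotProduct_le_sum_abs_mul_norm (v y : V → ℝ) : v ⬝ᵥ y ≤ (∑ i, |v i|) * ‖y‖ := by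
  rw [dotProduct, Finset.sum_mul]
  refine Finset.sum_le_sum fun i _ => (le_abs_self _).trans ?_
  rw [abs_mul]
  exact mul_le_mul_of_nonneg_left (norm_le_pi_norm y i) (abs_nonneg _)

lemma exists_mem_subgradient_two_mul_norm [Nonempty V] (x : V → ℝ) :
    ∃ v, v ∈ subgradient (fun y : V → ℝ => 2 * ‖y‖) x := by
  classical
  obtain ⟨p, hp⟩ := Finite.exists_max fun i => ‖x i‖
  have hpx : |x p| = ‖x‖ :=
    le_antisymm (norm_le_pi_norm x p) ((pi_norm_le_iff_of_nonneg (norm_nonneg _)).2 hp)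
  rcases le_total 0 (x p) with h | h
  · refine ⟨Pi.single p 2, mem_subgradient_of_le ?_ fun y => ?_⟩
    · simp [← hpx, abs_of_nonneg h]
    · rw [single_dotProduct]
      exact mul_le_mul_of_nonneg_left ((le_abs_self _).trans (norm_le_pi_norm y p)) zero_le_two
  · refine ⟨Pi.single p (-2), mem_subgradient_of_le ?_ fun y => ?_⟩
    · simp [← hpx, abs_of_nonpos h]
    · rw [single_dotProduct]
      linarith [(neg_le_abs (y p)).trans (norm_le_pi_norm y p)]

lemma dotProduct_eq_two_mul_norm {x v : V → ℝ}
    (hv : v ∈ subgradient (fun y : V → ℝ => 2 * ‖y‖) x) : v ⬝ᵥ x = 2 * ‖x‖ :=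
  dotProduct_eq_of_mem_subgradient (F := fun y : V → ℝ => 2 * ‖y‖) (by simp)
    (by simp [norm_smul]) hv

end Subgradient

/-! ### Midrange and sup norm -/

section Midrange

variable {V : Type*} [Fintype V]

lemma iInf_le_apply_le_iSup (x : V → ℝ) (i : V) : ⨅ j, x j ≤ x i ∧ x i ≤ ⨆ j, x j :=
  ⟨ciInf_le (Set.finite_range x).bddBelow i, le_ciSup (Set.finite_range x).bddAbove i⟩

variable [Nonempty V]

lemma iInf_le_iSup_of_fintype (x : V → ℝ) : ⨅ j, x j ≤ ⨆ j, x j := by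
  obtain ⟨i⟩ := ‹Nonempty V›
  exact (iInf_le_apply_le_iSup x i).1.trans (iInf_le_apply_le_iSup x i).2

lemma iSup_sub_iInf_le_two_mul_norm (x : V → ℝ) : (⨆ i, x i) - ⨅ i, x i ≤ 2 * ‖x‖ := by
  have h₁ : ⨆ i, x i ≤ ‖x‖ := ciSup_le fun i => (le_abs_self _).trans (norm_le_pi_norm x i)
  have h₂ : -‖x‖ ≤ ⨅ i, x i :=
    le_ciInf fun i => neg_le_of_abs_le (norm_le_pi_norm x i)
  linarith

lemma iSup_sub_iInf_eq_two_mul_norm {x : V → ℝ} (hx : (⨅ i, x i) + (⨆ i, x i) = 0) :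
    (⨆ i, x i) - ⨅ i, x i = 2 * ‖x‖ := by
  refine le_antisymm (iSup_sub_iInf_le_two_mul_norm x) ?_
  have h : ‖x‖ ≤ ⨆ i, x i := by
    refine (pi_norm_le_iff_of_nonneg ?_).2 fun i => ?_
    · linarith [iInf_le_iSup_of_fintype x]
    · have := iInf_le_apply_le_iSup x i
      exact abs_le.2 ⟨by linarith, this.2⟩
  linarith

lemma iInf_add_iSup_add_const (x : V → ℝ) (c : ℝ) :
    (⨅ i, (x + Function.const V c) i) + (⨆ i, (x + Function.const V c) i)
      = (⨅ i, x i) + (⨆ i, x i) + 2 * c := by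
  have h₁ : ⨅ i, (x + Function.const V c) i = (⨅ i, x i) + c :=
    (ciInf_add (Set.finite_range x).bddBelow c).symm
  have h₂ : ⨆ i, (x + Function.const V c) i = (⨆ i, x i) + c :=
    (ciSup_add (Set.finite_range x).bddAbove c).symm
  rw [h₁, h₂]
  ring

end Midrange

/-! ### Total variation and cuts -/

section TotalVariation

variable {V : Type*}

@[simp]
lemma edgeDiff_mk (x : V → ℝ) (i j : V) : edgeDiff x s(i, j) = |x i - x j| := rfl

lemma edgeDiff_nonneg (x : V → ℝ) (e : Sym2 V) : 0 ≤ edgeDiff x e := by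
  induction e with | _ i j => exact abs_nonneg _

lemma edgeDiff_smul (c : ℝ) (x : V → ℝ) (e : Sym2 V) :
    edgeDiff (c • x) e = |c| * edgeDiff x e := by
  induction e with | _ i j => simp [← mul_sub, abs_mul]

lemma edgeDiff_add_const (x : V → ℝ) (c : ℝ) (e : Sym2 V) :
    edgeDiff (x + Function.const V c) e = edgeDiff x e := by
  induction e with | _ i j => simp

variable [Fintype V] [DecidableEq V] (G : SimpleGraph V) [DecidableRel G.Adj] (w : Sym2 V → ℝ)

lemma totalVariation_smul (c : ℝ) (x : V → ℝ) :
    totalVariation G w (c • x) = |c| * totalVariation G w x := by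
  simp only [totalVariation, edgeDiff_smul, Finset.mul_sum]
  exact Finset.sum_congr rfl fun _ _ => by ring

lemma totalVariation_add_const (x : V → ℝ) (c : ℝ) :
    totalVariation G w (x + Function.const V c) = totalVariation G w x := by
  simp only [totalVariation, edgeDiff_add_const]

lemma totalVariation_zero : totalVariation G w 0 = 0 := by
  simpa using totalVariation_smul G w 0 0

lemma totalVariation_const (c : ℝ) : totalVariation G w (Function.const V c) = 0 := by
  simpa [totalVariation_zero] using totalVariation_add_const G w 0 c

variable {w} in
lemma totalVariation_nonneg (hw : ∀ e ∈ G.edgeSet, 0 ≤ w e) (x : V → ℝ) :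
    0 ≤ totalVariation G w x :=
  Finset.sum_nonneg fun e he =>
    mul_nonneg (hw e (G.mem_edgeFinset.1 he)) (edgeDiff_nonneg x e)

/-- A sum over the ordered pairs `(i, j)` with `i ∈ S`, `j ∉ S` is a sum over the undirected edges
of the cut; these are singled out by the factor `edgeDiff 1_S`, which is `1` on edges of the cut
and `0` on the others. -/
lemma sum_cut_eq_sum_edgeFinset (f : Sym2 V → ℝ) (S : Finset V) :
    (∑ i ∈ S, ∑ j ∈ Sᶜ, if G.Adj i j then f s(i, j) else 0)
      = ∑ e ∈ G.edgeFinset, f e * edgeDiff (fun i => if i ∈ S then 1 else 0) e := by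
  rw [← Finset.sum_product', ← Finset.sum_filter]
  symm
  rw [← Finset.sum_filter_of_ne
    (p := fun e => edgeDiff (fun i => if i ∈ S then (1 : ℝ) else 0) e ≠ 0)
    fun e _ h => right_ne_zero_of_mul h]
  symm
  refine Finset.sum_nbij (fun p => s(p.1, p.2)) ?_ ?_ ?_ ?_
  · rintro ⟨i, j⟩ h
    simp only [Finset.mem_filter, Finset.mem_product, Finset.mem_compl] at h
    simp [h.1.1, h.1.2, h.2]
  · rintro ⟨i, j⟩ h ⟨k, l⟩ h' heq
    simp only [Finset.coe_filter, Finset.mem_product, Finset.mem_compl, Set.mem_ofPred_eq] at h h'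
    rcases Sym2.eq_iff.1 heq with ⟨rfl, rfl⟩ | ⟨rfl, rfl⟩
    · rfl
    · exact absurd h.1.1 h'.1.2
  · intro e he
    induction e with | _ i j =>
    simp only [Finset.coe_filter, SimpleGraph.mem_edgeFinset, SimpleGraph.mem_edgeSet,
      Set.mem_ofPred_eq, edgeDiff_mk] at he
    obtain ⟨hadj, hne⟩ := he
    by_cases hi : i ∈ S <;> by_cases hj : j ∈ S
    · simp [hi, hj] at hne
    · exact ⟨(i, j), by simp [hi, hj, hadj], rfl⟩
    · exact ⟨(j, i), by simp [hi, hj, hadj.symm], Sym2.eq_swap⟩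
    · simp [hi, hj] at hne
  · rintro ⟨i, j⟩ h
    simp only [Finset.mem_filter, Finset.mem_product, Finset.mem_compl] at h
    simp [h.1.1, h.1.2]

lemma cutWeight_eq_totalVariation (S : Finset V) :
    cutWeight G w S = totalVariation G w (fun i => if i ∈ S then 1 else 0) :=
  sum_cut_eq_sum_edgeFinset G w S

end TotalVariation

/-! ### The coarea formula -/

section Coarea

variable {V : Type*}

lemma edgeDiff_superlevel (x : V → ℝ) (i j : V) (t : ℝ) :
    |(if t ≤ x i then (1 : ℝ) else 0) - (if t ≤ x j then (1 : ℝ) else 0)|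
      = (Set.uIoc (x i) (x j)).indicator (fun _ => 1) t := by
  by_cases hi : t ≤ x i <;> by_cases hj : t ≤ x j <;>
    simp [Set.indicator, Set.mem_uIoc, hi, hj, not_lt.2, not_le.1]

/-- Strictly between the minimum and the maximum, superlevel sets are proper. -/
lemma superlevel_proper [Fintype V] [Nonempty V] (x : V → ℝ) {t : ℝ}
    (ht : t ∈ Set.Ioo (⨅ i, x i) (⨆ i, x i)) :
    (Finset.univ.filter fun i => t ≤ x i) ≠ ∅ ∧
      (Finset.univ.filter fun i => t ≤ x i) ≠ Finset.univ := by
  obtain ⟨i, hi⟩ := exists_lt_of_lt_ciSup ht.2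
  obtain ⟨j, hj⟩ := exists_lt_of_ciInf_lt ht.1
  refine ⟨Finset.ne_empty_of_mem (a := i) (by simpa using hi.le), fun h => ?_⟩
  have hmem := Finset.mem_univ j
  rw [← h] at hmem
  exact hj.not_ge (by simpa using hmem)

lemma intervalIntegrable_edgeDiff_superlevel (x : V → ℝ) (e : Sym2 V) (a b : ℝ) :
    IntervalIntegrable (fun t => edgeDiff (fun i => if t ≤ x i then (1 : ℝ) else 0) e)
      volume a b := by
  induction e with | _ i j =>
  simp only [edgeDiff_mk, edgeDiff_superlevel]
  have h : IntegrableOn (fun _ : ℝ => (1 : ℝ)) (Set.uIoc a b) :=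
    integrableOn_const (by simp [Set.uIoc])
  exact intervalIntegrable_iff.2 (h.indicator measurableSet_uIoc)

/-- The coarea formula on a single edge. -/
lemma edgeDiff_eq_integral (x : V → ℝ) (e : Sym2 V) {a b : ℝ} (ha : ∀ i, a ≤ x i)
    (hb : ∀ i, x i ≤ b) :
    edgeDiff x e = ∫ t in a..b, edgeDiff (fun i => if t ≤ x i then (1 : ℝ) else 0) e := by
  induction e with | _ i j =>
  simp only [edgeDiff_mk, edgeDiff_superlevel]
  have hsub : Set.uIoc (x i) (x j) ⊆ Set.Ioc a b :=
    Set.Ioc_subset_Ioc (le_min (ha i) (ha j)) (max_le (hb i) (hb j))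
  rw [intervalIntegral.integral_of_le ((ha i).trans (hb i)),
    setIntegral_indicator measurableSet_uIoc, Set.inter_eq_right.2 hsub, setIntegral_const,
    smul_eq_mul, mul_one, Set.uIoc, Real.volume_real_Ioc_of_le min_le_max, max_sub_min_eq_abs,
    abs_sub_comm]

variable [Fintype V] [DecidableEq V] (G : SimpleGraph V) [DecidableRel G.Adj] (w : Sym2 V → ℝ)

lemma cutWeight_superlevel (x : V → ℝ) (t : ℝ) :
    cutWeight G w (Finset.univ.filter fun i => t ≤ x i)
      = ∑ e ∈ G.edgeFinset, w e * edgeDiff (fun i => if t ≤ x i then (1 : ℝ) else 0) e := by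
  simp [cutWeight_eq_totalVariation, totalVariation]

lemma intervalIntegrable_cutWeight (x : V → ℝ) (a b : ℝ) :
    IntervalIntegrable (fun t => cutWeight G w (Finset.univ.filter fun i => t ≤ x i))
      volume a b := by
  simp only [cutWeight_superlevel]
  have h := IntervalIntegrable.sum (μ := volume) (a := a) (b := b) G.edgeFinset
    fun e _ => (intervalIntegrable_edgeDiff_superlevel x e a b).const_mul (w e)
  rwa [Finset.sum_fn] at h

lemma totalVariation_eq_integral_cutWeight (x : V → ℝ) {a b : ℝ} (ha : ∀ i, a ≤ x i)
    (hb : ∀ i, x i ≤ b) :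
    totalVariation G w x
      = ∫ t in a..b, cutWeight G w (Finset.univ.filter fun i => t ≤ x i) := by
  simp only [cutWeight_superlevel]
  rw [intervalIntegral.integral_finsetSum fun e _ =>
    (intervalIntegrable_edgeDiff_superlevel x e a b).const_mul (w e)]
  refine Finset.sum_congr rfl fun e _ => ?_
  rw [intervalIntegral.integral_const_mul, ← edgeDiff_eq_integral x e ha hb]

variable [Nonempty V] {G w}

lemma mul_le_totalVariation {m : ℝ}
    (hm : ∀ S : Finset V, S ≠ ∅ → S ≠ Finset.univ → m ≤ cutWeight G w S) (x : V → ℝ) :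
    m * ((⨆ i, x i) - ⨅ i, x i) ≤ totalVariation G w x := by
  rw [totalVariation_eq_integral_cutWeight G w x (fun i => (iInf_le_apply_le_iSup x i).1)
    fun i => (iInf_le_apply_le_iSup x i).2]
  have h := intervalIntegral.integral_mono_on_of_le_Ioo (iInf_le_iSup_of_fintype x)
    (intervalIntegrable_const (c := m)) (intervalIntegrable_cutWeight G w x _ _)
    fun t ht => hm _ (superlevel_proper x ht).1 (superlevel_proper x ht).2
  rwa [intervalIntegral.integral_const, smul_eq_mul, mul_comm] at h

lemma totalVariation_le_mul {M : ℝ}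
    (hM : ∀ S : Finset V, S ≠ ∅ → S ≠ Finset.univ → cutWeight G w S ≤ M) (x : V → ℝ) :
    totalVariation G w x ≤ M * ((⨆ i, x i) - ⨅ i, x i) := by
  rw [totalVariation_eq_integral_cutWeight G w x (fun i => (iInf_le_apply_le_iSup x i).1)
    fun i => (iInf_le_apply_le_iSup x i).2]
  have h := intervalIntegral.integral_mono_on_of_le_Ioo (iInf_le_iSup_of_fintype x)
    (intervalIntegrable_cutWeight G w x _ _) (intervalIntegrable_const (c := M))
    fun t ht => hM _ (superlevel_proper x ht).1 (superlevel_proper x ht).2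
  rwa [intervalIntegral.integral_const, smul_eq_mul, mul_comm] at h

end Coarea

/-! ### Necessary conditions for eigenpairs -/

section Eigenpair

variable {V : Type*} [Fintype V] [DecidableEq V] {G : SimpleGraph V} [DecidableRel G.Adj]
  {w : Sym2 V → ℝ} {lam : ℝ} {x : V → ℝ}

lemma IsCutEigenpair.totalVariation_eq (h : IsCutEigenpair G w lam x) :
    totalVariation G w x = lam * (2 * ‖x‖) := by
  obtain ⟨-, v, hv, hu⟩ := isEigenpair_iff.1 h
  rw [← dotProduct_eq_of_mem_subgradient (totalVariation_zero G w)
    (by simp [totalVariation_smul]) hu, smul_dotProduct, dotProduct_eq_two_mul_norm hv, smul_eq_mul]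

lemma IsCutEigenpair.eq_div (h : IsCutEigenpair G w lam x) :
    lam = totalVariation G w x / (2 * ‖x‖) := by
  have : 0 < ‖x‖ := norm_pos_iff.2 h.1
  rw [h.totalVariation_eq]
  field_simp

/-- Subgradients of the total variation are orthogonal to constants. -/
lemma dotProduct_const_eq_zero {u : V → ℝ} (hu : u ∈ subgradient (totalVariation G w) x) (c : ℝ) :
    u ⬝ᵥ Function.const V c = 0 := by
  have key (d : ℝ) : u ⬝ᵥ Function.const V d ≤ 0 := by
    have h := hu (x + Function.const V d)
    rwa [add_sub_cancel_left, totalVariation_add_const, sub_self] at h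
  refine le_antisymm (key c) ?_
  have h := key (-c)
  have hneg : Function.const V (-c) = -Function.const V c := rfl
  rw [hneg, dotProduct_neg] at h
  linarith

lemma IsCutEigenpair.iInf_add_iSup_eq_zero [Nonempty V] (h : IsCutEigenpair G w lam x)
    (hlam : lam ≠ 0) : (⨅ i, x i) + (⨆ i, x i) = 0 := by
  obtain ⟨-, v, hv, hu⟩ := isEigenpair_iff.1 h
  -- The shift of `x` by `c` has midrange `0`, hence the least norm among all shifts.
  set c : ℝ := -((⨅ i, x i) + (⨆ i, x i)) / 2 with hc
  have hvc : v ⬝ᵥ Function.const V c = 0 := by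
    have h0 := dotProduct_const_eq_zero hu c
    rw [smul_dotProduct, smul_eq_mul] at h0
    exact (mul_eq_zero.1 h0).resolve_left hlam
  have hnorm : ‖x‖ ≤ ‖x + Function.const V c‖ := by
    have h1 := hv (x + Function.const V c)
    rw [add_sub_cancel_left, hvc] at h1
    linarith
  have hle : 2 * ‖x + Function.const V c‖ ≤ (⨆ i, x i) - ⨅ i, x i := by
    have h0 : (0 : ℝ) ≤ ((⨆ i, x i) - ⨅ i, x i) / 2 := by
      linarith [iInf_le_iSup_of_fintype x]
    have h1 := (pi_norm_le_iff_of_nonneg (x := x + Function.const V c) h0).2 fun i => by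
      have := iInf_le_apply_le_iSup x i
      rw [Pi.add_apply, Function.const_apply, Real.norm_eq_abs, abs_le]
      constructor <;> linarith
    linarith
  have h₁ : ⨆ i, x i ≤ ‖x‖ := ciSup_le fun i => (le_abs_self _).trans (norm_le_pi_norm x i)
  have h₂ : -‖x‖ ≤ ⨅ i, x i := le_ciInf fun i => neg_le_of_abs_le (norm_le_pi_norm x i)
  linarith

end Eigenpair

/-! ### Cuts as eigenvalues -/

section Cut

variable {V : Type*} [DecidableEq V]

/-- The vector that is `1` on `S` and `-1` off `S`. -/
def cutSign (S : Finset V) : V → ℝ := fun i => if i ∈ S then 1 else -1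

lemma cutSign_not_const {S : Finset V} (h : S ≠ ∅) [Fintype V] (h' : S ≠ Finset.univ) :
    ¬ ∀ i j, cutSign S i = cutSign S j := by
  obtain ⟨i, hi⟩ := Finset.nonempty_iff_ne_empty.2 h
  obtain ⟨j, hj⟩ : ∃ j, j ∉ S := by simpa [Finset.eq_univ_iff_forall] using h'
  intro hc
  have := hc i j
  simp only [cutSign, hi, hj, if_true, if_false] at this
  norm_num at this

variable [Fintype V]

lemma norm_cutSign [Nonempty V] (S : Finset V) : ‖cutSign S‖ = 1 := by
  have h (i : V) : ‖cutSign S i‖ = 1 := by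
    rw [cutSign]
    split_ifs <;> simp
  refine le_antisymm ((pi_norm_le_iff_of_nonneg zero_le_one).2 fun i => (h i).le) ?_
  obtain ⟨i⟩ := ‹Nonempty V›
  exact (h i).ge.trans (norm_le_pi_norm _ i)

lemma cutSign_ne_zero [Nonempty V] (S : Finset V) : cutSign S ≠ 0 :=
  norm_ne_zero_iff.1 (by simp [norm_cutSign])

lemma iInf_add_iSup_cutSign {S : Finset V} (h : S ≠ ∅) (h' : S ≠ Finset.univ) :
    (⨅ i, cutSign S i) + (⨆ i, cutSign S i) = 0 := by
  obtain ⟨i, hi⟩ := Finset.nonempty_iff_ne_empty.2 h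
  obtain ⟨j, hj⟩ : ∃ j, j ∉ S := by simpa [Finset.eq_univ_iff_forall] using h'
  have : Nonempty V := ⟨i⟩
  have h₁ : ⨆ i, cutSign S i = 1 :=
    le_antisymm (ciSup_le fun k => by rw [cutSign]; split_ifs <;> norm_num)
      (by simpa [cutSign, hi] using (iInf_le_apply_le_iSup (cutSign S) i).2)
  have h₂ : ⨅ i, cutSign S i = -1 :=
    le_antisymm (by simpa [cutSign, hj] using (iInf_le_apply_le_iSup (cutSign S) j).1)
      (le_ciInf fun k => by rw [cutSign]; split_ifs <;> norm_num)
  rw [h₁, h₂, neg_add_cancel]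

variable {G : SimpleGraph V} [DecidableRel G.Adj] {w : Sym2 V → ℝ}

lemma totalVariation_cutSign (S : Finset V) :
    totalVariation G w (cutSign S) = 2 * cutWeight G w S := by
  have h : cutSign S = (2 : ℝ) • (fun i => if i ∈ S then (1 : ℝ) else 0)
      + Function.const V (-1) := by
    ext i
    simp only [cutSign, Pi.add_apply, Pi.smul_apply, Function.const_apply, smul_eq_mul]
    split_ifs <;> norm_num
  rw [h, totalVariation_add_const, totalVariation_smul, ← cutWeight_eq_totalVariation,
    abs_of_pos two_pos]

lemma cutWeight_eq_div_cutSign [Nonempty V] (S : Finset V) :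
    cutWeight G w S = totalVariation G w (cutSign S) / (2 * ‖cutSign S‖) := by
  rw [totalVariation_cutSign, norm_cutSign]
  ring

/-- The functional `y ↦ ∑_{i ∈ S, j ∉ S} a_ij (y_i - y_j)` is represented by the vector of
outflows across the cut. -/
lemma exists_dotProduct_eq_sum_cut (a : V → V → ℝ) (S : Finset V) :
    ∃ u : V → ℝ, ∀ y, u ⬝ᵥ y = ∑ i ∈ S, ∑ j ∈ Sᶜ, a i j * (y i - y j) := by
  refine ⟨fun k => if k ∈ S then ∑ j ∈ Sᶜ, a k j else -∑ i ∈ S, a i k, fun y => ?_⟩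
  rw [dotProduct, ← Finset.sum_add_sum_compl S]
  simp only [mul_sub, Finset.sum_sub_distrib]
  rw [sub_eq_add_neg, Finset.sum_comm (s := S) (t := Sᶜ) (f := fun i j => a i j * y j),
    ← Finset.sum_neg_distrib]
  congr 1
  · exact Finset.sum_congr rfl fun i hi => by rw [if_pos hi, Finset.sum_mul]
  · exact Finset.sum_congr rfl fun j hj => by
      rw [if_neg (Finset.mem_compl.1 hj), neg_mul, Finset.sum_mul]

/-- The vector `u` with `u ⬝ᵥ y = ∑_{i ∈ S, j ∉ S} w_ij (y_i - y_j)` is bounded both by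
the total variation and by `|∂S| * (2‖·‖)`, with equality in both bounds at `cutSign S`. -/
lemma isCutEigenpair_cutSign [Nonempty V] (hw : ∀ e ∈ G.edgeSet, 0 ≤ w e) (S : Finset V) :
    IsCutEigenpair G w (cutWeight G w S) (cutSign S) := by
  refine isEigenpair_iff.2 ⟨cutSign_ne_zero S, ?_⟩
  set a : V → V → ℝ := fun i j => if G.Adj i j then w s(i, j) else 0 with ha
  have ha0 (i j : V) : 0 ≤ a i j := by
    simp only [ha]
    split_ifs with h
    · exact hw _ (G.mem_edgeSet.2 h)
    · exact le_rfl
  have hcut : cutWeight G w S = ∑ i ∈ S, ∑ j ∈ Sᶜ, a i j := rfl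
  obtain ⟨u, hu⟩ := exists_dotProduct_eq_sum_cut a S
  have hux : u ⬝ᵥ cutSign S = 2 * cutWeight G w S := by
    rw [hu, hcut, Finset.mul_sum]
    refine Finset.sum_congr rfl fun i hi => ?_
    rw [Finset.mul_sum]
    refine Finset.sum_congr rfl fun j hj => ?_
    rw [cutSign, if_pos hi, cutSign, if_neg (Finset.mem_compl.1 hj)]
    ring
  have huI (y : V → ℝ) : u ⬝ᵥ y ≤ totalVariation G w y := by
    have h := sum_cut_eq_sum_edgeFinset G (fun e => w e * edgeDiff y e) S
    calc u ⬝ᵥ y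
        ≤ ∑ i ∈ S, ∑ j ∈ Sᶜ, if G.Adj i j then w s(i, j) * edgeDiff y s(i, j) else 0 := by
          rw [hu]
          refine Finset.sum_le_sum fun i _ => Finset.sum_le_sum fun j _ => ?_
          refine (mul_le_mul_of_nonneg_left (le_abs_self _) (ha0 i j)).trans_eq ?_
          simp [ha]
      _ ≤ totalVariation G w y := by
          rw [h]
          refine Finset.sum_le_sum fun e he => ?_
          refine mul_le_of_le_one_right
            (mul_nonneg (hw e (G.mem_edgeFinset.1 he)) (edgeDiff_nonneg y e)) ?_
          induction e with | _ i j =>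
          rw [edgeDiff_mk]
          split_ifs <;> norm_num
  have huH (y : V → ℝ) : u ⬝ᵥ y ≤ cutWeight G w S * (2 * ‖y‖) := by
    rw [hu, hcut, Finset.sum_mul]
    refine Finset.sum_le_sum fun i _ => ?_
    rw [Finset.sum_mul]
    refine Finset.sum_le_sum fun j _ => mul_le_mul_of_nonneg_left ?_ (ha0 i j)
    have hi := (le_abs_self _).trans (norm_le_pi_norm y i)
    have hj := (neg_le_abs _).trans (norm_le_pi_norm y j)
    linarith
  by_cases h0 : cutWeight G w S = 0
  · obtain ⟨v, hv⟩ := exists_mem_subgradient_two_mul_norm (cutSign S)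
    refine ⟨v, hv, mem_subgradient_of_le ?_ fun y => ?_⟩
    · simp [h0, totalVariation_cutSign]
    · simpa [h0] using totalVariation_nonneg G hw y
  · have hpos : 0 < cutWeight G w S :=
      (Finset.sum_nonneg fun i _ => Finset.sum_nonneg fun j _ => ha0 i j).lt_of_ne' h0
    refine ⟨(cutWeight G w S)⁻¹ • u, mem_subgradient_of_le ?_ fun y => ?_, ?_⟩
    · rw [smul_dotProduct, hux, norm_cutSign, smul_eq_mul]
      field_simp
    · rw [smul_dotProduct, smul_eq_mul, inv_mul_le_iff₀ hpos]
      exact huH y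
    · rw [smul_inv_smul₀ h0]
      exact mem_subgradient_of_le (hux.trans (totalVariation_cutSign S).symm) huI

lemma cutWeight_pos_of_connected (hG : G.Connected) (hw : ∀ e ∈ G.edgeSet, 0 < w e)
    {S : Finset V} (h : S ≠ ∅) (h' : S ≠ Finset.univ) : 0 < cutWeight G w S := by
  obtain ⟨i, hi⟩ := Finset.nonempty_iff_ne_empty.2 h
  obtain ⟨j, hj⟩ : ∃ j, j ∉ S := by simpa [Finset.eq_univ_iff_forall] using h'
  obtain ⟨p⟩ := hG.preconnected i j
  obtain ⟨d, -, hd₁, hd₂⟩ := p.exists_boundary_dart (S : Set V) hi hj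
  have ha0 (k l : V) : 0 ≤ if G.Adj k l then w s(k, l) else 0 := by
    split_ifs with hkl
    · exact (hw _ (G.mem_edgeSet.2 hkl)).le
    · exact le_rfl
  refine Finset.sum_pos' (fun k _ => Finset.sum_nonneg fun l _ => ha0 k l) ⟨d.fst, hd₁, ?_⟩
  refine Finset.sum_pos' (fun l _ => ha0 _ l) ⟨d.snd, Finset.mem_compl.2 hd₂, ?_⟩
  rw [if_pos d.adj]
  exact hw _ (G.mem_edgeSet.2 d.adj)

end Cut

/-! ### Min-cut and max-cut as eigenvalues -/

theorem mainTheorem6 {V : Type*} [Fintype V] [DecidableEq V] [Nontrivial V]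
    (G : SimpleGraph V) [DecidableRel G.Adj] (w : Sym2 V → ℝ)
    (hw : ∀ e ∈ G.edgeSet, 0 ≤ w e) :
    -- zero is the trivial eigenvalue, and it is the smallest eigenvalue
    trivialCutEigenvalues G w = {0} ∧
    IsLeast (cutEigenvalues G w) 0 ∧
    -- min-cut
    (∃ lam₂ : ℝ,
      IsLeast {c : ℝ | ∃ S : Finset V, S ≠ ∅ ∧ S ≠ Finset.univ ∧ c = cutWeight G w S} lam₂ ∧
      IsLeast {r : ℝ | ∃ x : V → ℝ, x ≠ 0 ∧ (⨅ i, x i) + (⨆ i, x i) = 0 ∧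
        r = totalVariation G w x / (2 * ‖x‖)} lam₂ ∧
      IsLeast (nontrivialCutEigenvalues G w) lam₂ ∧
      (G.Connected → (∀ e ∈ G.edgeSet, 0 < w e) →
        IsLeast {lam : ℝ | lam ∈ cutEigenvalues G w ∧ lam ≠ 0} lam₂)) ∧
    -- max-cut
    (∃ lamMax : ℝ,
      IsGreatest {c : ℝ | ∃ S : Finset V, S ≠ ∅ ∧ S ≠ Finset.univ ∧ c = cutWeight G w S}
        lamMax ∧
      IsGreatest {r : ℝ | ∃ x : V → ℝ, x ≠ 0 ∧ r = totalVariation G w x / (2 * ‖x‖)} lamMax ∧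
      IsGreatest (cutEigenvalues G w) lamMax) := by
  have hzero : trivialCutEigenvalues G w = {0} := by
    ext lam
    rw [Set.mem_singleton_iff]
    constructor
    · rintro ⟨x, hx, h⟩
      obtain ⟨i⟩ := ‹Nontrivial V›.to_nonempty
      have hx' : x = Function.const V (x i) := funext fun j => hx j i
      rw [h.eq_div, hx', totalVariation_const, zero_div]
    · rintro rfl
      obtain ⟨v, hv⟩ := exists_mem_subgradient_two_mul_norm (Function.const V (1 : ℝ))
      refine ⟨Function.const V 1, fun _ _ => rfl, isEigenpair_iff.2
        ⟨Function.const_ne_zero.2 one_ne_zero, v, hv, mem_subgradient_of_le ?_ fun y => ?_⟩⟩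
      · rw [zero_smul, zero_dotProduct, totalVariation_const]
      · simpa using totalVariation_nonneg G hw y
  obtain ⟨p, q, hpq⟩ := exists_pair_ne V
  -- Proper subsets exist as `V` has two points, so the finitely many proper cuts have extrema.
  set P : Finset (Finset V) := Finset.univ.filter fun S => S ≠ ∅ ∧ S ≠ Finset.univ
  have hP : P.Nonempty := by
    refine ⟨{p}, Finset.mem_filter.2 ⟨Finset.mem_univ _, Finset.singleton_ne_empty p, fun h => ?_⟩⟩
    have := Finset.mem_univ q
    rw [← h, Finset.mem_singleton] at this
    exact hpq this.symm
  obtain ⟨A, hA, hAmin⟩ := P.exists_min_image (cutWeight G w) hP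
  obtain ⟨B, hB, hBmax⟩ := P.exists_max_image (cutWeight G w) hP
  obtain ⟨-, hA₁, hA₂⟩ := Finset.mem_filter.1 hA
  obtain ⟨-, hB₁, hB₂⟩ := Finset.mem_filter.1 hB
  have hm (S : Finset V) (h : S ≠ ∅) (h' : S ≠ Finset.univ) : cutWeight G w A ≤ cutWeight G w S :=
    hAmin S (Finset.mem_filter.2 ⟨Finset.mem_univ _, h, h'⟩)
  have hM (S : Finset V) (h : S ≠ ∅) (h' : S ≠ Finset.univ) : cutWeight G w S ≤ cutWeight G w B :=
    hBmax S (Finset.mem_filter.2 ⟨Finset.mem_univ _, h, h'⟩)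
  have hratio_min (x : V → ℝ) (hx : x ≠ 0) (hmid : (⨅ i, x i) + (⨆ i, x i) = 0) :
      cutWeight G w A ≤ totalVariation G w x / (2 * ‖x‖) := by
    have : 0 < ‖x‖ := norm_pos_iff.2 hx
    rw [le_div_iff₀ (by positivity), ← iSup_sub_iInf_eq_two_mul_norm hmid]
    exact mul_le_totalVariation hm x
  have hcutB : 0 ≤ cutWeight G w B := by
    rw [cutWeight_eq_totalVariation]
    exact totalVariation_nonneg G hw _
  have hratio_max (x : V → ℝ) (hx : x ≠ 0) :
      totalVariation G w x / (2 * ‖x‖) ≤ cutWeight G w B := by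
    have : 0 < ‖x‖ := norm_pos_iff.2 hx
    rw [div_le_iff₀ (by positivity)]
    exact (totalVariation_le_mul hM x).trans
      (mul_le_mul_of_nonneg_left (iSup_sub_iInf_le_two_mul_norm x) hcutB)
  have hnontriv : IsLeast (nontrivialCutEigenvalues G w) (cutWeight G w A) := by
    refine ⟨⟨cutSign A, cutSign_not_const hA₁ hA₂, isCutEigenpair_cutSign hw A⟩, ?_⟩
    rintro lam ⟨x, hx, h⟩
    by_cases hlam : lam = 0
    · -- Shift `x` to midrange `0`; its total variation `0` does not change.
      set c : ℝ := -((⨅ i, x i) + (⨆ i, x i)) / 2 with hc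
      have hne : x + Function.const V c ≠ 0 := fun h0 => hx fun i j => by
        have hi := congrFun h0 i
        have hj := congrFun h0 j
        simp only [Pi.add_apply, Function.const_apply, Pi.zero_apply] at hi hj
        linarith
      have hle := hratio_min _ hne (by rw [iInf_add_iSup_add_const, hc]; ring)
      rwa [totalVariation_add_const, h.totalVariation_eq, hlam, zero_mul, zero_div,
        ← hlam] at hle
    · rw [h.eq_div]
      exact hratio_min x h.1 (h.iInf_add_iSup_eq_zero hlam)
  refine ⟨hzero, ⟨?_, ?_⟩, ⟨cutWeight G w A, ⟨⟨A, hA₁, hA₂, rfl⟩, ?_⟩,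
    ⟨⟨cutSign A, cutSign_ne_zero A, iInf_add_iSup_cutSign hA₁ hA₂, cutWeight_eq_div_cutSign A⟩, ?_⟩,
    hnontriv, fun hG hpos => ⟨⟨?_, ?_⟩, ?_⟩⟩,
    cutWeight G w B, ⟨⟨B, hB₁, hB₂, rfl⟩, ?_⟩,
    ⟨⟨cutSign B, cutSign_ne_zero B, cutWeight_eq_div_cutSign B⟩, ?_⟩,
    ⟨cutSign B, isCutEigenpair_cutSign hw B⟩, ?_⟩
  · obtain ⟨x, -, h⟩ : (0 : ℝ) ∈ trivialCutEigenvalues G w := hzero ▸ rfl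
    exact ⟨x, h⟩
  · rintro lam ⟨x, h⟩
    rw [h.eq_div]
    exact div_nonneg (totalVariation_nonneg G hw x) (by positivity)
  · rintro c ⟨S, h, h', rfl⟩
    exact hm S h h'
  · rintro r ⟨x, hx, hmid, rfl⟩
    exact hratio_min x hx hmid
  · exact ⟨cutSign A, isCutEigenpair_cutSign hw A⟩
  · exact (cutWeight_pos_of_connected hG hpos hA₁ hA₂).ne'
  · rintro lam ⟨⟨x, h⟩, hlam⟩
    refine hnontriv.2 ⟨x, fun hx => hlam ?_, h⟩
    have hmem : lam ∈ trivialCutEigenvalues G w := ⟨x, hx, h⟩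
    rwa [hzero] at hmem
  · rintro c ⟨S, h, h', rfl⟩
    exact hM S h h'
  · rintro r ⟨x, hx, rfl⟩
    exact hratio_max x hx
  · rintro lam ⟨x, h⟩
    rw [h.eq_div]
    exact hratio_max x h.1
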